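/- Let $(M,g)$ be a smooth pseudo-Riemannian manifold (metric of arbitrary signature) of dimension $n\ge 3$, with Levi-Civita connection $\nabla$ and Christoffel symbols $\Gamma^p_{il}$. Write $X_{[ab]}=X_{ab}-X_{ba}$; let $R_{jkl}{}^m$ be the Riemann tensor, with $[\nabla_j,\nabla_k]u_l=R_{jkl}{}^m u_m$, let $R_{ab}=R_{amb}{}^m$ be the Ricci tensor, $R=R_m{}^m$ the scalar curvature, and let $$C_{jkl}{}^m=R_{jkl}{}^m+\frac{1}{n-2}\left(\delta_{[j}{}^mR_{k]l}+R_{[j}{}^mg_{k]l}\right)-\frac{1}{(n-1)(n-2)}\,R\,\delta_{[j}{}^mg_{k]l}$$ be the Weyl tensor. A symmetric tensor field $b_{ij}$ is called Weyl compatible if $b_{am}C_{bcl}{}^m+b_{bm}C_{cal}{}^m+b_{cm}C_{abl}{}^m=0$ on $M$. Let $T_{ij}$ be the stress-energy tensor given by Einstein's equations $R_{ij}-\frac{R}{2}g_{ij}=8\pi T_{ij}$. Let $\Pi_l=\nabla_mC_{jkl}{}^m\,dx^j\wedge dx^k$, a covector-valued 2-form, and let $D\Pi_l=d\Pi_l-\Gamma^p_{il}\,dx^i\wedge\Pi_p$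 be its exterior covariant derivative. Theorem. The Ricci tensor $R_{ij}$ is Weyl compatible if and only if $D\Pi_l=0$ on $M$; likewise, the stress-energy tensor $T_{ij}$ is Weyl compatible if and only if $D\Pi_l=0$ on $M$. -/

import Mathlib

open scoped Manifold ContDiff Topology

noncomputable section

namespace PseudoRiemannian

/-- Coordinate space `ℝⁿ`. -/
abbrev Coord (n : ℕ) : Type := EuclideanSpace ℝ (Fin n)

/-- A pseudo-Riemannian metric on a smooth `n`-manifold: a smooth field of symmetric
nondegenerate bilinear forms on the tangent spaces, of arbitrary signature. -/
structure Metric (n : ℕ) (M : Type*) [TopologicalSpace M] [ChartedSpace (Coord n) M]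
    [IsManifold (𝓡 n) ∞ M] where
  /-- The bilinear form on each tangent space. -/
  inner (x : M) : TangentSpace (𝓡 n) x →L[ℝ] TangentSpace (𝓡 n) x →L[ℝ] ℝ
  symm (x : M) (v w : TangentSpace (𝓡 n) x) : inner x v w = inner x w v
  nondegenerate (x : M) (v : TangentSpace (𝓡 n) x) (hv : ∀ w, inner x v w = 0) : v = 0
  contMDiff : ContMDiff (𝓡 n) ((𝓡 n).prod 𝓘(ℝ, Coord n →L[ℝ] Coord n →L[ℝ] ℝ)) ∞
    (fun x ↦ Bundle.TotalSpace.mk' (Coord n →L[ℝ] Coord n →L[ℝ] ℝ) x (inner x))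

section Coordinates

/-! Tensor calculus in one coordinate system.  `G y i j = g_{ij}(y)` is the matrix of components
of the metric at the point with coordinates `y`. -/

variable {n : ℕ}

/-- The partial derivative `∂_i f` at `y`. -/
def pderiv (i : Fin n) (f : Coord n → ℝ) (y : Coord n) : ℝ :=
  fderiv ℝ f y (EuclideanSpace.single i 1)

/-- Christoffel symbols of the Levi-Civita connection: `christoffel G m i j y = Γ^m_{ij}(y)`, with
`Γ^m_{ij} = ½ g^{mp} (∂_i g_{jp} + ∂_j g_{ip} - ∂_p g_{ij})`. -/
def christoffel (G : Coord n → Matrix (Fin n) (Fin n) ℝ) (m i j : Fin n) (y : Coord n) : ℝ :=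
  (1 / 2) * ∑ p, (G y)⁻¹ m p *
    (pderiv i (fun z ↦ G z j p) y + pderiv j (fun z ↦ G z i p) y - pderiv p (fun z ↦ G z i j) y)

/-- Riemann tensor: `riemann G j k l m y = R_{jkl}{}^m(y)`, with the sign convention
`(∇_j ∇_k - ∇_k ∇_j) u_l = R_{jkl}{}^m u_m`. -/
def riemann (G : Coord n → Matrix (Fin n) (Fin n) ℝ) (j k l m : Fin n) (y : Coord n) : ℝ :=
  pderiv k (christoffel G m j l) y - pderiv j (christoffel G m k l) y +
    ∑ p, (christoffel G m k p y * christoffel G p j l y -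
      christoffel G m j p y * christoffel G p k l y)

/-- Ricci tensor `R_{ab} = R_{amb}{}^m`. -/
def ricci (G : Coord n → Matrix (Fin n) (Fin n) ℝ) (a b : Fin n) (y : Coord n) : ℝ :=
  ∑ m, riemann G a m b m y

/-- The mixed Ricci tensor: `ricciMixed G j m y = R_j{}^m = R_{jp} g^{pm}`. -/
def ricciMixed (G : Coord n → Matrix (Fin n) (Fin n) ℝ) (j m : Fin n) (y : Coord n) : ℝ :=
  ∑ p, ricci G j p y * (G y)⁻¹ p m

/-- Scalar curvature `R = R_m{}^m`. -/
def scalar (G : Coord n → Matrix (Fin n) (Fin n) ℝ) (y : Coord n) : ℝ :=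
  ∑ m, ricciMixed G m m y

/-- The Kronecker symbol `δ_j{}^m`. -/
def delta (j m : Fin n) : ℝ := if j = m then 1 else 0

/-- Weyl tensor: `weyl G j k l m y = C_{jkl}{}^m(y)`, where, with `X_{[ab]} = X_{ab} - X_{ba}`,
`C_{jkl}{}^m = R_{jkl}{}^m + (δ_{[j}{}^m R_{k]l} + R_{[j}{}^m g_{k]l}) / (n - 2)
  - R δ_{[j}{}^m g_{k]l} / ((n - 1)(n - 2))`. -/
def weyl (G : Coord n → Matrix (Fin n) (Fin n) ℝ) (j k l m : Fin n) (y : Coord n) : ℝ :=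
  riemann G j k l m y
    + 1 / ((n : ℝ) - 2) *
      ((delta j m * ricci G k l y - delta k m * ricci G j l y) +
        (ricciMixed G j m y * G y k l - ricciMixed G k m y * G y j l))
    - 1 / (((n : ℝ) - 1) * ((n : ℝ) - 2)) *
      (scalar G y * (delta j m * G y k l - delta k m * G y j l))

/-- Covariant derivative of the Weyl tensor:
`nablaWeyl G i j k l m y = ∇_i C_{jkl}{}^m = ∂_i C_{jkl}{}^m - Γ^p_{ij} C_{pkl}{}^m
  - Γ^p_{ik} C_{jpl}{}^m - Γ^p_{il} C_{jkp}{}^m + Γ^m_{ip} C_{jkl}{}^p`. -/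
def nablaWeyl (G : Coord n → Matrix (Fin n) (Fin n) ℝ) (i j k l m : Fin n) (y : Coord n) : ℝ :=
  pderiv i (weyl G j k l m) y +
    ∑ p, (-(christoffel G p i j y * weyl G p k l m y)
      - christoffel G p i k y * weyl G j p l m y
      - christoffel G p i l y * weyl G j k p m y
      + christoffel G m i p y * weyl G j k l p y)

/-- Divergence of the Weyl tensor: `divWeyl G j k l y = ∇_m C_{jkl}{}^m`. -/
def divWeyl (G : Coord n → Matrix (Fin n) (Fin n) ℝ) (j k l : Fin n) (y : Coord n) : ℝ :=
  ∑ m, nablaWeyl G m j k l m y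

/-- The covector-valued 2-form `Π_l = ∇_m C_{jkl}{}^m dx^j ∧ dx^k`, through its values on pairs of
coordinate vectors: `weylForm G l a b y = Π_l(∂_a, ∂_b)`, where
`(dx^j ∧ dx^k)(∂_a, ∂_b) = δ^j_a δ^k_b - δ^j_b δ^k_a`. -/
def weylForm (G : Coord n → Matrix (Fin n) (Fin n) ℝ) (l a b : Fin n) (y : Coord n) : ℝ :=
  ∑ j, ∑ k, divWeyl G j k l y * (delta j a * delta k b - delta j b * delta k a)

/-- Exterior derivative of a scalar 2-form with components `η_{ab} = η(∂_a, ∂_b)`: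
`(dη)(∂_a, ∂_b, ∂_c) = ∂_a η_{bc} + ∂_b η_{ca} + ∂_c η_{ab}`. -/
def extDerivTwoForm (η : Fin n → Fin n → Coord n → ℝ) (a b c : Fin n) (y : Coord n) : ℝ :=
  pderiv a (η b c) y + pderiv b (η c a) y + pderiv c (η a b) y

/-- Wedge product of a 1-form and a 2-form:
`(θ ∧ η)(∂_a, ∂_b, ∂_c) = θ_a η_{bc} + θ_b η_{ca} + θ_c η_{ab}`. -/
def wedgeOneTwo (θ : Fin n → Coord n → ℝ) (η : Fin n → Fin n → Coord n → ℝ) (a b c : Fin n)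
    (y : Coord n) : ℝ :=
  θ a y * η b c y + θ b y * η c a y + θ c y * η a b y

/-- Exterior covariant derivative of a covector-valued 2-form `η_l`, with respect to the
Levi-Civita connection 1-forms `θ^p_l = Γ^p_{il} dx^i`:  `D η_l = d η_l - θ^p_l ∧ η_p`. -/
def extCovDeriv (G : Coord n → Matrix (Fin n) (Fin n) ℝ)
    (η : Fin n → Fin n → Fin n → Coord n → ℝ) (l a b c : Fin n) (y : Coord n) : ℝ :=
  extDerivTwoForm (η l) a b c y - ∑ p, wedgeOneTwo (fun i ↦ christoffel G p i l) (η p) a b c y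

/-- The stress-energy tensor, given by Einstein's equations `R_{ij} - (R / 2) g_{ij} = 8π T_{ij}`. -/
def stressEnergy (G : Coord n → Matrix (Fin n) (Fin n) ℝ) (i j : Fin n) (y : Coord n) : ℝ :=
  1 / (8 * Real.pi) * (ricci G i j y - scalar G y / 2 * G y i j)

end Coordinates

section Manifold

variable {n : ℕ} {M : Type*} [TopologicalSpace M] [ChartedSpace (Coord n) M]
  [IsManifold (𝓡 n) ∞ M]

/-- Components `g_{ij}(y)` of the metric in a chart `e`, at the point `e.symm y`; meaningful for
`y ∈ e.target`. -/
def Metric.components (g : Metric n M) (e : OpenPartialHomeomorph M (Coord n)) (y : Coord n) :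
    Matrix (Fin n) (Fin n) ℝ :=
  Matrix.of fun i j ↦ g.inner (e.symm y)
    (mfderiv (𝓡 n) (𝓡 n) e.symm y (EuclideanSpace.single i (1 : ℝ)))
    (mfderiv (𝓡 n) (𝓡 n) e.symm y (EuclideanSpace.single j (1 : ℝ)))

/-- A tensor field of type `(0,2)`, given by its components `b e i j` in every chart `e`, is *Weyl
compatible* if it is symmetric and `b_{am} C_{bcl}{}^m + b_{bm} C_{cal}{}^m + b_{cm} C_{abl}{}^m = 0`
in every smooth chart of the manifold. -/
def Metric.IsWeylCompatible (g : Metric n M)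
    (b : OpenPartialHomeomorph M (Coord n) → Fin n → Fin n → Coord n → ℝ) : Prop :=
  ∀ e ∈ IsManifold.maximalAtlas (𝓡 n) ∞ M, ∀ y ∈ e.target,
    (∀ i j, b e i j y = b e j i y) ∧
    ∀ i j k l, ∑ m, (b e i m y * weyl (g.components e) j k l m y +
      b e j m y * weyl (g.components e) k i l m y +
      b e k m y * weyl (g.components e) i j l m y) = 0

/-- The Ricci tensor field of `g`. -/
def Metric.ricciTensor (g : Metric n M) :
    OpenPartialHomeomorph M (Coord n) → Fin n → Fin n → Coord n → ℝ :=
  fun e ↦ ricci (g.components e)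

/-- The stress-energy tensor field of `g`. -/
def Metric.stressEnergyTensor (g : Metric n M) :
    OpenPartialHomeomorph M (Coord n) → Fin n → Fin n → Coord n → ℝ :=
  fun e ↦ stressEnergy (g.components e)

/-- `D Π_l = 0`: the exterior covariant derivative of the covector-valued 2-form
`Π_l = ∇_m C_{jkl}{}^m dx^j ∧ dx^k` vanishes on the manifold. -/
def Metric.WeylFormClosed (g : Metric n M) : Prop :=
  ∀ e ∈ IsManifold.maximalAtlas (𝓡 n) ∞ M, ∀ y ∈ e.target, ∀ l a b c,
    extCovDeriv (g.components e) (weylForm (g.components e)) l a b c y = 0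

end Manifold

end PseudoRiemannian

end

/-! Let `D` be the exterior covariant derivative on covector-valued forms and let `cyc σ` be the
cyclic sum of `σ_{am} R_{bcl}{}^m`. Both conditions reduce to the vanishing of `cyc Ric`.

On the Weyl side, the terms separating `C` from `R` cancel in the cyclic sum for every symmetric `b`
for which `b_{im} R_j{}^m` is symmetric in `i, j` (`sum_mul_weyl`). This covers both `Ric` and `g`,
and `cyc g = 0` by the first Bianchi identity. Hence adding a multiple of `R g` changes nothing, and
the Ricci and stress-energy tensors are treated together.

On the other side, the contracted Bianchi identities show that the divergence of `C` is `D` of a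
combination of `Ric` and `R g` (`div_weyl`). Since `D²` acts through the curvature
(`covExtTwo_covExt`) and `cyc (R g) = 0`, `D` of the divergence is `-(n-3)/(n-2) · cyc Ric`. For `n
≥ 4` the factor is nonzero. For `n = 3` it vanishes, but then `cyc Ric` vanishes identically: it is
alternating in three indices and trace-free.

The tensor identities are proved over an arbitrary real algebra with commuting derivations, where no
differentiability conditions arise. They are then applied to the smooth functions on the target of a
chart. -/

noncomputable section

/-! ### Formal metrics and the Levi-Civita connection -/

namespace PseudoRiemannian

/-- A metric over a commutative algebra with commuting derivations `∂_i`: the algebraic setting for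
tensor calculus in one coordinate system. -/
structure FormalMetric (n : ℕ) (A : Type*) [CommRing A] [Algebra ℝ A] where
  /-- The partial derivatives. -/
  d : Fin n → Derivation ℝ A A
  d_comm (i j : Fin n) (a : A) : d i (d j a) = d j (d i a)
  /-- The components `g_{ij}`. -/
  g : Matrix (Fin n) (Fin n) A
  /-- The components `g^{ij}` of the inverse. -/
  h : Matrix (Fin n) (Fin n) A
  g_symm : g.transpose = g
  g_mul_h : g * h = 1

namespace FormalMetric

variable {n : ℕ} {A : Type*} [CommRing A] [Algebra ℝ A] (F : FormalMetric n A)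

lemma h_mul_g : F.h * F.g = 1 := mul_eq_one_comm.mp F.g_mul_h

lemma h_symm : F.h.transpose = F.h := by
  have e : F.h.transpose * F.g = 1 := by
    rw [← F.g_symm, ← Matrix.transpose_mul, F.g_mul_h, Matrix.transpose_one]
  calc F.h.transpose = F.h.transpose * (F.g * F.h) := by rw [F.g_mul_h, mul_one]
    _ = F.h := by rw [← mul_assoc, e, one_mul]

lemma g_symm_apply (i j : Fin n) : F.g i j = F.g j i := congrFun (congrFun F.g_symm j) i

lemma h_symm_apply (i j : Fin n) : F.h i j = F.h j i := congrFun (congrFun F.h_symm j) i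

/-- Entrywise partial derivative of a matrix. -/
def dMat (i : Fin n) (X : Matrix (Fin n) (Fin n) A) : Matrix (Fin n) (Fin n) A := X.map (F.d i)

@[simp] lemma dMat_apply (i : Fin n) (X : Matrix (Fin n) (Fin n) A) (a b : Fin n) :
    F.dMat i X a b = F.d i (X a b) := rfl

lemma dMat_add (i : Fin n) (X Y : Matrix (Fin n) (Fin n) A) :
    F.dMat i (X + Y) = F.dMat i X + F.dMat i Y := by ext; simp

lemma dMat_sub (i : Fin n) (X Y : Matrix (Fin n) (Fin n) A) :
    F.dMat i (X - Y) = F.dMat i X - F.dMat i Y := by ext; simp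

lemma dMat_mul (i : Fin n) (X Y : Matrix (Fin n) (Fin n) A) :
    F.dMat i (X * Y) = F.dMat i X * Y + X * F.dMat i Y := by
  ext a b
  simp [Matrix.mul_apply, Finset.sum_add_distrib, add_comm, mul_comm]

lemma dMat_transpose (i : Fin n) (X : Matrix (Fin n) (Fin n) A) :
    F.dMat i X.transpose = (F.dMat i X).transpose := rfl

lemma dMat_one (i : Fin n) : F.dMat i 1 = 0 := by
  ext a b
  by_cases hab : a = b <;> simp [hab]

lemma dMat_comm (i j : Fin n) (X : Matrix (Fin n) (Fin n) A) :
    F.dMat i (F.dMat j X) = F.dMat j (F.dMat i X) := by ext; simp [F.d_comm i j]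

/-- Christoffel symbols with lowered index: `lowConn i l p = Γ_{il,p}`. -/
def lowConn (i : Fin n) : Matrix (Fin n) (Fin n) A :=
  Matrix.of fun l p ↦ (1 / 2 : ℝ) • (F.d i (F.g l p) + F.d l (F.g i p) - F.d p (F.g i l))

/-- Christoffel symbols: `conn i l m = Γ^m_{il}`. -/
def conn (i : Fin n) : Matrix (Fin n) (Fin n) A := F.lowConn i * F.h

lemma conn_symm (i l : Fin n) (m : Fin n) : F.conn i l m = F.conn l i m := by
  simp only [conn, Matrix.mul_apply, lowConn, Matrix.of_apply]
  refine Finset.sum_congr rfl fun p _ ↦ ?_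
  rw [F.g_symm_apply i l, add_comm (F.d i _)]

lemma conn_mul_g (i : Fin n) : F.conn i * F.g = F.lowConn i := by
  rw [conn, mul_assoc, F.h_mul_g, mul_one]

/-- The metric is parallel. -/
lemma dMat_g (i : Fin n) : F.dMat i F.g = F.conn i * F.g + F.g * (F.conn i).transpose := by
  have e : F.g * (F.conn i).transpose = (F.lowConn i).transpose := by
    rw [← F.conn_mul_g, Matrix.transpose_mul, F.g_symm]
  rw [e, F.conn_mul_g]
  ext a b
  simp only [dMat_apply, lowConn, Matrix.add_apply, Matrix.of_apply, Matrix.transpose_apply]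
  rw [F.g_symm_apply b a, ← smul_add]
  have : F.d i (F.g a b) + F.d a (F.g i b) - F.d b (F.g i a) +
      (F.d i (F.g a b) + F.d b (F.g i a) - F.d a (F.g i b)) = (2 : ℝ) • F.d i (F.g a b) := by
    rw [two_smul]; ring
  rw [this, smul_smul]
  norm_num

/-- The inverse metric is parallel. -/
lemma dMat_h (i : Fin n) : F.dMat i F.h = -((F.conn i).transpose * F.h + F.h * F.conn i) := by
  have e := congrArg (F.dMat i) F.h_mul_g
  rw [dMat_mul, dMat_one, dMat_g] at e
  have e2 : F.dMat i F.h = F.dMat i F.h * F.g * F.h := by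
    rw [mul_assoc, F.g_mul_h, mul_one]
  have e3 : F.h * (F.conn i * F.g) * F.h = F.h * F.conn i := by
    rw [mul_assoc, mul_assoc, F.g_mul_h, mul_one]
  rw [e2, eq_neg_of_add_eq_zero_left e, neg_mul, mul_add, add_mul, e3, ← mul_assoc F.h F.g,
    F.h_mul_g, one_mul, add_comm]

/-! ### Curvature and its symmetries -/

/-- Riemann tensor: `curv j k l m = R_{jkl}{}^m`. -/
def curv (j k : Fin n) : Matrix (Fin n) (Fin n) A :=
  F.dMat k (F.conn j) - F.dMat j (F.conn k) + (F.conn j * F.conn k - F.conn k * F.conn j)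

lemma curv_swap (j k : Fin n) : F.curv j k = -F.curv k j := by
  simp only [curv]; abel

/-- Everything cancels because the connection is torsion-free, that is, `conn` is symmetric in its
first two indices. -/
lemma curv_bianchi (j k l m : Fin n) :
    F.curv j k l m + F.curv k l j m + F.curv l j k m = 0 := by
  simp only [curv, Matrix.add_apply, Matrix.sub_apply, dMat_apply, Matrix.mul_apply]
  simp only [F.conn_symm k j, F.conn_symm l j, F.conn_symm l k]
  ring

/-- The differential Bianchi identity. -/
lemma curv_bianchi_diff (i j k : Fin n) :
    (F.dMat i (F.curv j k) - F.conn i * F.curv j k + F.curv j k * F.conn i) +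
    (F.dMat j (F.curv k i) - F.conn j * F.curv k i + F.curv k i * F.conn j) +
    (F.dMat k (F.curv i j) - F.conn k * F.curv i j + F.curv i j * F.conn k) = 0 := by
  -- Only the matrix indices are differentiated covariantly; corrections for the form indices would
  -- cancel in the cyclic sum. Once partial derivatives commute, a noncommutative polynomial
  -- identity is left.
  simp only [curv, dMat_add, dMat_sub, dMat_mul, F.dMat_comm j i, F.dMat_comm k i, F.dMat_comm k j]
  noncomm_ring

/-- Differentiating `∇g = 0` once more and using that partial derivatives of `g` commute shows that
the curvature annihilates `g`. -/
lemma curv_mul_g_transpose (j k : Fin n) :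
    (F.curv j k * F.g).transpose = -(F.curv j k * F.g) := by
  have e := F.dMat_comm j k F.g
  simp only [dMat_g, dMat_add, dMat_mul, dMat_transpose] at e
  have t : (F.curv j k * F.g).transpose = F.g * (F.curv j k).transpose := by
    rw [Matrix.transpose_mul, F.g_symm]
  rw [t, eq_neg_iff_add_eq_zero]
  simp only [curv, Matrix.transpose_add, Matrix.transpose_sub, Matrix.transpose_mul]
  rw [← sub_eq_zero] at e
  rw [← neg_eq_zero, ← e]
  noncomm_ring

lemma eq_of_two_mul_eq {a b : A} (hab : 2 * a = 2 * b) : a = b := by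
  have e := congrArg (fun x ↦ (1 / 2 : ℝ) • x) hab
  simpa only [two_mul, ← two_smul ℝ, smul_smul, one_div, inv_mul_cancel₀ (two_ne_zero' ℝ),
    one_smul] using e

lemma sum_sum_eq_zero_of_antisymm (f : Fin n → Fin n → A) (hf : ∀ i j, f i j = -f j i) :
    ∑ i, ∑ j, f i j = 0 := by
  apply eq_of_two_mul_eq
  rw [mul_zero, two_mul]
  nth_rewrite 2 [Finset.sum_comm]
  simp only [← Finset.sum_add_distrib]
  exact Finset.sum_eq_zero fun i _ ↦ Finset.sum_eq_zero fun j _ ↦ by rw [hf i j]; ring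

/-- The Riemann tensor with lowered last index. -/
def lowCurv (j k l m : Fin n) : A := (F.curv j k * F.g) l m

lemma lowCurv_swap_left (j k l m : Fin n) : F.lowCurv j k l m = -F.lowCurv k j l m := by
  rw [lowCurv, F.curv_swap, Matrix.neg_mul]; rfl

lemma lowCurv_swap_right (j k l m : Fin n) : F.lowCurv j k l m = -F.lowCurv j k m l :=
  congrFun (congrFun (F.curv_mul_g_transpose j k) m) l

lemma lowCurv_bianchi (j k l m : Fin n) :
    F.lowCurv j k l m + F.lowCurv k l j m + F.lowCurv l j k m = 0 := by
  simp only [lowCurv, Matrix.mul_apply, ← Finset.sum_add_distrib, ← add_mul, F.curv_bianchi,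
    zero_mul, Finset.sum_const_zero]

/-- A signed sum of the four first Bianchi identities obtained by rotating the indices leaves twice
the claim, once both antisymmetries are used. -/
lemma lowCurv_pair_symm (j k l m : Fin n) : F.lowCurv j k l m = F.lowCurv l m j k := by
  apply eq_of_two_mul_eq
  have b1 := F.lowCurv_bianchi j k l m
  have b2 := F.lowCurv_bianchi k l m j
  have b3 := F.lowCurv_bianchi l m j k
  have b4 := F.lowCurv_bianchi m j k l
  have s := F.lowCurv_swap_left
  have t := F.lowCurv_swap_right
  linear_combination b1 + b2 - b3 - b4 - t k l m j - t l m k j - s m k l j + s m j l k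
    - t j m l k + s j l m k - t l j m k + s m j k l + t j k m l + t k m j l

lemma curv_eq_lowCurv (j k l m : Fin n) : F.curv j k l m = ∑ p, F.lowCurv j k l p * F.h p m := by
  have e : F.curv j k = F.curv j k * F.g * F.h := by rw [mul_assoc, F.g_mul_h, mul_one]
  conv_lhs => rw [e, Matrix.mul_apply]
  rfl

/-- Ricci tensor `R_{ab} = R_{amb}{}^m`. -/
def ric : Matrix (Fin n) (Fin n) A := Matrix.of fun a b ↦ ∑ m, F.curv a m b m

lemma ric_symm (a b : Fin n) : F.ric a b = F.ric b a := by
  simp only [ric, Matrix.of_apply, curv_eq_lowCurv]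
  rw [Finset.sum_comm]
  refine Finset.sum_congr rfl fun m _ ↦ Finset.sum_congr rfl fun p _ ↦ ?_
  rw [F.lowCurv_pair_symm, F.h_symm_apply]

/-- The mixed Ricci tensor `R_j{}^m`. -/
def ricMix : Matrix (Fin n) (Fin n) A := F.ric * F.h

/-- Scalar curvature. -/
def scal : A := F.ricMix.trace

/-- The Riemann tensor with both last indices raised is antisymmetric in them. -/
lemma h_mul_curv_transpose (j k : Fin n) :
    (F.h * F.curv j k).transpose = -(F.h * F.curv j k) := by
  have e : F.h * F.curv j k = F.h * (F.curv j k * F.g) * F.h := by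
    rw [mul_assoc, mul_assoc, F.g_mul_h, mul_one]
  rw [e, Matrix.transpose_mul, Matrix.transpose_mul, F.curv_mul_g_transpose, F.h_symm]
  noncomm_ring

lemma ricMix_eq (k i : Fin n) : F.ricMix k i = ∑ j, (F.h * F.curv k j) i j := by
  simp only [ricMix, Matrix.mul_apply, ric, Matrix.of_apply, Finset.sum_mul]
  rw [Finset.sum_comm]
  refine Finset.sum_congr rfl fun j _ ↦ Finset.sum_congr rfl fun p _ ↦ ?_
  rw [F.h_symm_apply, mul_comm]

/-! ### The contracted second Bianchi identity -/

/-- Divergence `∇_m X_j{}^m`. -/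
def divMix (X : Matrix (Fin n) (Fin n) A) (j : Fin n) : A :=
  ∑ m, (F.d m (X j m) + ∑ p, (-(F.conn m j p * X p m) + F.conn m p m * X j p))

/-- As `h` is parallel, multiplying the differential Bianchi identity by `h` raises an index. -/
lemma raised_bianchi_diff (i j k : Fin n) :
    (F.dMat i (F.h * F.curv j k) + (F.conn i).transpose * (F.h * F.curv j k)
      + F.h * F.curv j k * F.conn i) +
    (F.dMat j (F.h * F.curv k i) + (F.conn j).transpose * (F.h * F.curv k i)
      + F.h * F.curv k i * F.conn j) +
    (F.dMat k (F.h * F.curv i j) + (F.conn k).transpose * (F.h * F.curv i j)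
      + F.h * F.curv i j * F.conn k) = 0 := by
  have e := congrArg (fun X ↦ F.h * X) (F.curv_bianchi_diff i j k)
  simp only [mul_zero] at e
  simp only [dMat_mul, dMat_h]
  rw [← e]
  noncomm_ring

/-- Covariant derivative along `∂_i` in the two upper indices. -/
def upCov (i : Fin n) (X : Matrix (Fin n) (Fin n) A) : Matrix (Fin n) (Fin n) A :=
  F.dMat i X + (F.conn i).transpose * X + X * F.conn i

lemma upCov_apply (i : Fin n) (X : Matrix (Fin n) (Fin n) A) (a b : Fin n) :
    F.upCov i X a b =
      F.d i (X a b) + ∑ p, F.conn i p a * X p b + ∑ p, X a p * F.conn i p b := by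
  simp only [upCov, Matrix.add_apply, Matrix.mul_apply, dMat_apply, Matrix.transpose_apply]

lemma upCov_transpose (i : Fin n) (X : Matrix (Fin n) (Fin n) A) :
    F.upCov i X.transpose = (F.upCov i X).transpose := by
  ext a b
  simp only [upCov_apply, Matrix.transpose_apply, mul_comm (X _ _)]
  ring

section Contraction

variable (S : Fin n → Fin n → Matrix (Fin n) (Fin n) A)

/-- One of the two Christoffel terms contracts an antisymmetric pair of `S` with the symmetric pair
of `conn`, so it drops out. -/
lemma sum_upCov_left (hform : ∀ j k, S j k = -S k j) (hmat : ∀ j k, (S j k).transpose = -S j k)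
    (k : Fin n) : ∑ i, ∑ j, F.upCov i (S j k) i j =
      -∑ i, (F.d i (∑ j, S k j i j) + ∑ p, F.conn i p i * ∑ j, S k j p j) := by
  have z : ∑ i, ∑ j, ∑ p, S j k i p * F.conn i p j = 0 := by
    have e (i : Fin n) : ∑ j, ∑ p, S j k i p * F.conn i p j
        = ∑ p, ∑ j, S j k i p * F.conn i p j := Finset.sum_comm
    simp only [e]
    refine sum_sum_eq_zero_of_antisymm _ fun i p ↦ ?_
    rw [← Finset.sum_neg_distrib]
    refine Finset.sum_congr rfl fun j _ ↦ ?_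
    have h := congrFun (congrFun (hmat j k) p) i
    rw [Matrix.transpose_apply, Matrix.neg_apply] at h
    rw [h, F.conn_symm i p, neg_mul]
  simp only [upCov_apply, Finset.sum_add_distrib, z, add_zero, map_sum, neg_add, Finset.mul_sum]
  congr 1
  · rw [← Finset.sum_neg_distrib]
    refine Finset.sum_congr rfl fun i _ ↦ ?_
    rw [← Finset.sum_neg_distrib]
    refine Finset.sum_congr rfl fun j _ ↦ ?_
    rw [hform j k, Matrix.neg_apply, map_neg]
  · rw [← Finset.sum_neg_distrib]
    refine Finset.sum_congr rfl fun i _ ↦ ?_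
    rw [← Finset.sum_neg_distrib, Finset.sum_comm]
    refine Finset.sum_congr rfl fun p _ ↦ ?_
    rw [← Finset.sum_neg_distrib]
    refine Finset.sum_congr rfl fun j _ ↦ ?_
    rw [hform j k, Matrix.neg_apply, mul_neg]

lemma sum_upCov_middle (hform : ∀ j k, S j k = -S k j)
    (hmat : ∀ j k, (S j k).transpose = -S j k) (k : Fin n) :
    ∑ i, ∑ j, F.upCov j (S k i) i j = ∑ i, ∑ j, F.upCov i (S j k) i j := by
  rw [Finset.sum_comm]
  refine Finset.sum_congr rfl fun x _ ↦ Finset.sum_congr rfl fun y _ ↦ ?_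
  rw [hform k y, ← hmat, upCov_transpose, Matrix.transpose_apply]

/-- The two Christoffel terms are equal. For the curvature they supply the lower-index correction in
`divMix`, which `sum_upCov_left` lacks. -/
lemma sum_upCov_right (hform : ∀ j k, S j k = -S k j)
    (hmat : ∀ j k, (S j k).transpose = -S j k) (k : Fin n) :
    ∑ i, ∑ j, F.upCov k (S i j) i j =
      F.d k (∑ i, ∑ j, S i j i j) + 2 * ∑ i, ∑ p, F.conn i k p * ∑ j, S p j i j := by
  simp only [upCov_apply, Finset.sum_add_distrib, map_sum, two_mul, Finset.mul_sum, add_assoc]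
  refine congrArg₂ (· + ·) rfl (congrArg₂ (· + ·) ?_ ?_)
  · symm
    rw [Finset.sum_comm]
    refine Finset.sum_congr rfl fun p _ ↦ ?_
    rw [Finset.sum_comm]
    exact Finset.sum_congr rfl fun j _ ↦ Finset.sum_congr rfl fun i _ ↦ by rw [F.conn_symm i k]
  · symm
    rw [Finset.sum_comm]
    have e (p : Fin n) : ∑ i, ∑ j, F.conn i k p * S p j i j
        = ∑ j, ∑ i, F.conn i k p * S p j i j := Finset.sum_comm
    simp only [e]
    rw [Finset.sum_comm]
    refine Finset.sum_congr rfl fun j _ ↦ Finset.sum_congr rfl fun p _ ↦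
      Finset.sum_congr rfl fun i _ ↦ ?_
    have h := congrFun (congrFun (hmat j p) i) j
    rw [Matrix.transpose_apply, Matrix.neg_apply] at h
    rw [hform p j, Matrix.neg_apply, ← h, F.conn_symm i k, mul_comm]

end Contraction

/-- The contracted Bianchi identity `2 ∇_m R_k{}^m = ∂_k R`. -/
lemma two_mul_divMix_ricMix (k : Fin n) : 2 * F.divMix F.ricMix k = F.d k F.scal := by
  have hform (j k : Fin n) : F.h * F.curv j k = -(F.h * F.curv k j) := by
    rw [F.curv_swap, Matrix.mul_neg]
  have key (i j : Fin n) : F.upCov i (F.h * F.curv j k) i j + F.upCov j (F.h * F.curv k i) i j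
      + F.upCov k (F.h * F.curv i j) i j = 0 :=
    congrFun (congrFun (F.raised_bianchi_diff i j k) i) j
  have sum := Finset.sum_eq_zero fun i (_ : i ∈ Finset.univ) ↦
    Finset.sum_eq_zero fun j (_ : j ∈ Finset.univ) ↦ key i j
  simp only [Finset.sum_add_distrib] at sum
  have t1 := F.sum_upCov_left (fun j k ↦ F.h * F.curv j k) hform F.h_mul_curv_transpose k
  have t2 := F.sum_upCov_middle (fun j k ↦ F.h * F.curv j k) hform F.h_mul_curv_transpose k
  have t3 := F.sum_upCov_right (fun j k ↦ F.h * F.curv j k) hform F.h_mul_curv_transpose k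
  simp only [← ricMix_eq, Finset.sum_add_distrib] at t1 t2 t3
  simp only [divMix, scal, Matrix.trace, Matrix.diag_apply, Finset.sum_add_distrib,
    Finset.sum_neg_distrib]
  linear_combination -sum + t3 + t2 + 2 * t1

/-! ### Divergences and exterior covariant derivatives -/

/-- Covariant derivative `∇_i T_{jkl}{}^m`. -/
def nabla (T : Fin n → Fin n → Fin n → Fin n → A) (i j k l m : Fin n) : A :=
  F.d i (T j k l m) + ∑ p, (-(F.conn i j p * T p k l m) - F.conn i k p * T j p l m
    - F.conn i l p * T j k p m + F.conn i p m * T j k l p)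

/-- Divergence `∇_m T_{jkl}{}^m`. -/
def div (T : Fin n → Fin n → Fin n → Fin n → A) (j k l : Fin n) : A :=
  ∑ m, F.nabla T m j k l m

lemma div_add (T U : Fin n → Fin n → Fin n → Fin n → A) (j k l : Fin n) :
    F.div (fun a b c e ↦ T a b c e + U a b c e) j k l = F.div T j k l + F.div U j k l := by
  simp only [div, nabla, map_add, ← Finset.sum_add_distrib]
  refine Finset.sum_congr rfl fun m _ ↦ ?_
  rw [add_add_add_comm, ← Finset.sum_add_distrib]
  congr 1
  exact Finset.sum_congr rfl fun p _ ↦ by ring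

/-- The divergence of the part of a tensor antisymmetric in the first two indices. -/
lemma div_antisymm (T : Fin n → Fin n → Fin n → Fin n → A) (j k l : Fin n) :
    F.div (fun a b c e ↦ T a b c e - T b a c e) j k l = F.div T j k l - F.div T k j l := by
  simp only [div, nabla, map_sub, ← Finset.sum_sub_distrib]
  refine Finset.sum_congr rfl fun m _ ↦ ?_
  rw [add_sub_add_comm, ← Finset.sum_sub_distrib]
  congr 1
  exact Finset.sum_congr rfl fun p _ ↦ by ring

/-- Exterior covariant derivative of a covector-valued 1-form `σ_l = σ_{kl} dx^k`. -/
def covExt (σ : Matrix (Fin n) (Fin n) A) (j k l : Fin n) : A :=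
  F.d j (σ k l) - F.d k (σ j l) - ∑ p, (F.conn j l p * σ k p - F.conn k l p * σ j p)

lemma covExt_add (σ τ : Matrix (Fin n) (Fin n) A) (j k l : Fin n) :
    F.covExt (σ + τ) j k l = F.covExt σ j k l + F.covExt τ j k l := by
  simp only [covExt, Matrix.add_apply, map_add, mul_add, Finset.sum_add_distrib,
    Finset.sum_sub_distrib]
  ring

lemma covExt_smul (c : ℝ) (σ : Matrix (Fin n) (Fin n) A) (j k l : Fin n) :
    F.covExt (c • σ) j k l = c • F.covExt σ j k l := by
  simp only [covExt, Matrix.smul_apply, Derivation.map_smul, mul_smul_comm, ← smul_sub,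
    ← Finset.smul_sum]

lemma d_g (i j k : Fin n) :
    F.d i (F.g j k) = ∑ p, F.conn i j p * F.g p k + ∑ p, F.conn i k p * F.g j p := by
  have h := congrFun (congrFun (F.dMat_g i) j) k
  simp only [Matrix.add_apply, dMat_apply, Matrix.mul_apply, Matrix.transpose_apply] at h
  rw [h]
  simp only [mul_comm (F.g j _)]

/-- Since `g` is parallel and the connection torsion-free, only the derivative of `f` survives. -/
lemma covExt_smul_g (f : A) (j k l : Fin n) :
    F.covExt (f • F.g) j k l = F.d j f * F.g k l - F.d k f * F.g j l := by
  simp only [covExt, Matrix.smul_apply, smul_eq_mul, Derivation.leibniz, d_g,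
    Finset.sum_sub_distrib, mul_left_comm _ f, ← Finset.mul_sum, F.conn_symm k j]
  ring

/-- Contracted second Bianchi identity: `∇_m R_{jkl}{}^m = ∇_k R_{jl} - ∇_j R_{kl}`. -/
lemma div_curv (j k l : Fin n) :
    F.div (fun a b c e ↦ F.curv a b c e) j k l = -F.covExt F.ric j k l := by
  have key (m : Fin n) := congrFun (congrFun (F.curv_bianchi_diff m j k) l) m
  have sum := Finset.sum_eq_zero fun m (_ : m ∈ Finset.univ) ↦ key m
  simp only [Matrix.add_apply, Matrix.sub_apply, dMat_apply, Matrix.mul_apply,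
    Finset.sum_add_distrib, Finset.sum_sub_distrib] at sum
  have s1 (k m : Fin n) : F.curv m k = -F.curv k m := F.curv_swap m k
  simp only [s1 j, Matrix.neg_apply, map_neg, mul_neg, neg_mul, Finset.sum_neg_distrib] at sum
  simp only [div, nabla, covExt, ric, Matrix.of_apply, map_sum, Finset.sum_add_distrib,
    Finset.sum_sub_distrib, Finset.sum_neg_distrib, Finset.mul_sum]
  -- The form-index corrections present in `div`, but not in `curv_bianchi_diff`, match the products
  -- of `conn` and `curv` in the traced Bianchi identity, by the symmetry of `conn`.
  have e1 : ∑ x, ∑ p, F.conn x j p * F.curv p k l x =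
      -∑ x, ∑ p, F.curv k x l p * F.conn j p x := by
    rw [Finset.sum_comm, ← Finset.sum_neg_distrib]
    refine Finset.sum_congr rfl fun p _ ↦ ?_
    rw [← Finset.sum_neg_distrib]
    refine Finset.sum_congr rfl fun x _ ↦ ?_
    rw [F.curv_swap p k, F.conn_symm, Matrix.neg_apply]; ring
  have e2 : ∑ x, ∑ p, F.conn x k p * F.curv j p l x =
      ∑ x, ∑ p, F.curv j x l p * F.conn k p x := by
    rw [Finset.sum_comm]
    refine Finset.sum_congr rfl fun p _ ↦ Finset.sum_congr rfl fun x _ ↦ ?_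
    rw [F.conn_symm]; ring
  have e3 : ∑ x, ∑ p, F.conn x p x * F.curv j k l p
    = ∑ x, ∑ p, F.curv j k l p * F.conn x p x := by simp only [mul_comm]
  have e4 (j k : Fin n) : ∑ x, ∑ p, F.conn j l p * F.curv k x p x
    = ∑ p, ∑ x, F.conn j l p * F.curv k x p x := Finset.sum_comm
  rw [e1, e2, e3, ← e4, ← e4]
  linear_combination sum

lemma div_delta_mul (L : Matrix (Fin n) (Fin n) A) (j k l : Fin n) :
    F.div (fun a b c e ↦ (1 : Matrix (Fin n) (Fin n) A) a e * L b c) j k l =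
      F.d j (L k l) - ∑ p, (F.conn j k p * L p l + F.conn j l p * L k p) := by
  have e (m : Fin n) : F.nabla (fun a b c e ↦ (1 : Matrix (Fin n) (Fin n) A) a e * L b c) m j k l m
      = (1 : Matrix (Fin n) (Fin n) A) j m *
        (F.d m (L k l) - ∑ p, (F.conn m k p * L p l + F.conn m l p * L k p)) := by
    have d1 : F.d m ((1 : Matrix (Fin n) (Fin n) A) j m) = 0 :=
      congrFun (congrFun (F.dMat_one m) j) m
    have z : ∑ p, (-(F.conn m j p * ((1 : Matrix (Fin n) (Fin n) A) p m * L k l))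
        + F.conn m p m * ((1 : Matrix (Fin n) (Fin n) A) j p * L k l)) = 0 := by
      simp only [Matrix.one_apply, Finset.sum_add_distrib, ite_mul, mul_ite, one_mul, zero_mul,
        mul_zero, Finset.sum_neg_distrib, Finset.sum_ite_eq, Finset.sum_ite_eq', Finset.mem_univ,
        if_true]
      simp
    simp only [nabla, Derivation.leibniz, d1, mul_zero, add_zero, smul_eq_mul]
    rw [mul_sub, sub_eq_add_neg, ← zero_add (-_), ← z, Finset.mul_sum,
      ← Finset.sum_neg_distrib, ← Finset.sum_add_distrib]
    congr 1
    exact Finset.sum_congr rfl fun p _ ↦ by ring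
  simp only [div, e]
  simp only [Matrix.one_apply, ite_mul, one_mul, zero_mul, Finset.sum_ite_eq,
    Finset.mem_univ, if_true]

lemma div_mul_g (X : Matrix (Fin n) (Fin n) A) (j k l : Fin n) :
    F.div (fun a b c e ↦ X a e * F.g b c) j k l = F.divMix X j * F.g k l := by
  simp only [div, divMix, nabla, Finset.sum_mul]
  refine Finset.sum_congr rfl fun m _ ↦ ?_
  rw [Derivation.leibniz, d_g, smul_eq_mul, smul_eq_mul, add_mul, Finset.sum_mul, mul_add,
    Finset.mul_sum, Finset.mul_sum, mul_comm (F.g k l), add_comm _ (F.d m _ * _), add_assoc,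
    ← Finset.sum_add_distrib, ← Finset.sum_add_distrib]
  congr 1
  exact Finset.sum_congr rfl fun p _ ↦ by ring

lemma divMix_add (X Y : Matrix (Fin n) (Fin n) A) (j : Fin n) :
    F.divMix (X + Y) j = F.divMix X j + F.divMix Y j := by
  simp only [divMix, Matrix.add_apply, map_add, mul_add, Finset.sum_add_distrib,
    Finset.sum_neg_distrib]
  ring

lemma divMix_smul (c : ℝ) (X : Matrix (Fin n) (Fin n) A) (j : Fin n) :
    F.divMix (c • X) j = c • F.divMix X j := by
  simp only [divMix, Matrix.smul_apply, Derivation.map_smul, mul_smul_comm, ← smul_neg,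
    ← smul_add, ← Finset.smul_sum]

lemma divMix_smul_one (f : A) (j : Fin n) :
    F.divMix (f • (1 : Matrix (Fin n) (Fin n) A)) j = F.d j f := by
  have d1 (m : Fin n) : F.d m ((1 : Matrix (Fin n) (Fin n) A) j m) = 0 :=
    congrFun (congrFun (F.dMat_one m) j) m
  simp only [divMix, Matrix.smul_apply, smul_eq_mul, Derivation.leibniz, d1, mul_zero, zero_add]
  simp only [Matrix.one_apply, Finset.sum_add_distrib, ite_mul, mul_ite, one_mul, zero_mul,
        mul_zero, mul_one, Finset.sum_neg_distrib, Finset.sum_ite_eq, Finset.sum_ite_eq',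
        Finset.mem_univ, if_true]
  ring

/-- Exterior covariant derivative of a covector-valued 2-form. -/
def covExtTwo (η : Fin n → Fin n → Fin n → A) (l a b c : Fin n) : A :=
  F.d a (η b c l) + F.d b (η c a l) + F.d c (η a b l) -
    ∑ p, (F.conn a l p * η b c p + F.conn b l p * η c a p + F.conn c l p * η a b p)

/-- The cyclic sum `σ_{am} R_{bcl}{}^m + σ_{bm} R_{cal}{}^m + σ_{cm} R_{abl}{}^m`. -/
def cyc (σ : Matrix (Fin n) (Fin n) A) (l a b c : Fin n) : A :=
  ∑ m, (σ a m * F.curv b c l m + σ b m * F.curv c a l m + σ c m * F.curv a b l m)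

/-- The square of the exterior covariant derivative is the action of the curvature. -/
lemma covExtTwo_covExt (σ : Matrix (Fin n) (Fin n) A) (l a b c : Fin n) :
    F.covExtTwo (F.covExt σ) l a b c = F.cyc σ l a b c := by
  -- Quadratic Christoffel terms become matrix products, as in `curv`. Second derivatives of `σ` and
  -- products of `conn` with first derivatives of `σ` cancel cyclically.
  have two (x y z : Fin n) : ∑ p, ∑ q, F.conn x l p * (F.conn y p q * σ z q)
      = ∑ m, σ z m * (F.conn x * F.conn y) l m := by
    rw [Finset.sum_comm]
    refine Finset.sum_congr rfl fun m _ ↦ ?_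
    rw [Matrix.mul_apply, Finset.mul_sum]
    exact Finset.sum_congr rfl fun p _ ↦ by ring
  simp only [covExtTwo, covExt, cyc, map_sub, map_sum, Derivation.leibniz, smul_eq_mul, mul_sub,
    Finset.mul_sum, Finset.sum_add_distrib, Finset.sum_sub_distrib, two, curv, Matrix.add_apply,
    Matrix.sub_apply, dMat_apply, mul_add, F.d_comm b a, F.d_comm c a, F.d_comm c b]
  ring

lemma cyc_add (σ τ : Matrix (Fin n) (Fin n) A) (l a b c : Fin n) :
    F.cyc (σ + τ) l a b c = F.cyc σ l a b c + F.cyc τ l a b c := by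
  simp only [cyc, Matrix.add_apply, add_mul, Finset.sum_add_distrib]
  ring

lemma cyc_smul (f : A) (σ : Matrix (Fin n) (Fin n) A) (l a b c : Fin n) :
    F.cyc (f • σ) l a b c = f * F.cyc σ l a b c := by
  simp only [cyc, Matrix.smul_apply, smul_eq_mul, Finset.mul_sum]
  exact Finset.sum_congr rfl fun p _ ↦ by ring

/-- Contracting with `g` lowers the last index, and the cyclic sum becomes the first Bianchi
identity. -/
lemma cyc_g (l a b c : Fin n) : F.cyc F.g l a b c = 0 := by
  have e (x y z : Fin n) : ∑ m, F.g x m * F.curv y z l m = -F.lowCurv y z x l := by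
    rw [F.lowCurv_swap_right y z x l, neg_neg, lowCurv, Matrix.mul_apply]
    refine Finset.sum_congr rfl fun m _ ↦ ?_
    rw [F.g_symm_apply x m, mul_comm]
  simp only [cyc, Finset.sum_add_distrib, e]
  linear_combination -F.lowCurv_bianchi b c a l

/-! ### The Weyl tensor: compatibility and divergence -/

/-- Weyl tensor `C_{jkl}{}^m`. -/
def weyl (j k l m : Fin n) : A :=
  F.curv j k l m
    + (1 / ((n : ℝ) - 2)) •
      (((1 : Matrix (Fin n) (Fin n) A) j m * F.ric k l
          - (1 : Matrix (Fin n) (Fin n) A) k m * F.ric j l) +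
        (F.ricMix j m * F.g k l - F.ricMix k m * F.g j l))
    - (1 / (((n : ℝ) - 1) * ((n : ℝ) - 2))) •
      (F.scal * ((1 : Matrix (Fin n) (Fin n) A) j m * F.g k l
        - (1 : Matrix (Fin n) (Fin n) A) k m * F.g j l))

omit [Algebra ℝ A] in
lemma sum_one_mul (b : Matrix (Fin n) (Fin n) A) (i j : Fin n) (x : A) :
    ∑ m, b i m * ((1 : Matrix (Fin n) (Fin n) A) j m * x) = b i j * x := by
  simp [Matrix.one_apply]

/-- The part of the Weyl tensor involving the Ricci tensor drops out of the compatibility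
condition. -/
lemma sum_mul_weyl (b : Matrix (Fin n) (Fin n) A) (hb : ∀ i j, b i j = b j i)
    (hr : ∀ i j, ∑ m, b i m * F.ricMix j m = ∑ m, b j m * F.ricMix i m) (l i j k : Fin n) :
    ∑ m, (b i m * F.weyl j k l m + b j m * F.weyl k i l m + b k m * F.weyl i j l m) =
      F.cyc b l i j k := by
  have e (i j k : Fin n) : ∑ m, b i m * F.weyl j k l m = ∑ m, b i m * F.curv j k l m
      + (1 / ((n : ℝ) - 2)) • ((b i j * F.ric k l - b i k * F.ric j l) +
        ((∑ m, b i m * F.ricMix j m) * F.g k l - (∑ m, b i m * F.ricMix k m) * F.g j l))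
      - (1 / (((n : ℝ) - 1) * ((n : ℝ) - 2))) •
        (F.scal * (b i j * F.g k l - b i k * F.g j l)) := by
    rw [← sum_one_mul b i j, ← sum_one_mul b i k, ← sum_one_mul b i j, ← sum_one_mul b i k]
    simp only [weyl, mul_sub, mul_add, Finset.sum_sub_distrib, Finset.sum_add_distrib,
      mul_smul_comm, ← Finset.smul_sum, Finset.sum_mul, mul_assoc, Finset.mul_sum,
      mul_left_comm F.scal]
  simp only [cyc, Finset.sum_add_distrib, e]
  rw [hb j i, hb k i, hb k j, hr j i, hr k i, hr k j]
  -- Each correction bracket has zero cyclic sum by the symmetries `hb` and `hr`, whatever its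
  -- coefficient.
  have c (p q r : A) (s t : ℝ) (u v w u' v' w' : A) (h : u + v + w = 0) (h' : u' + v' + w' = 0) :
      p + s • u - t • u' + (q + s • v - t • v') + (r + s • w - t • w') = p + q + r := by
    have h1 : s • u + s • v + s • w = 0 := by rw [← smul_add, ← smul_add, h, smul_zero]
    have h2 : t • u' + t • v' + t • w' = 0 := by rw [← smul_add, ← smul_add, h', smul_zero]
    linear_combination h1 - h2
  apply c <;> ring

/-- The matrix `Ric · h · Ric` is symmetric, as `Ric` and `h` are. -/
lemma ric_mul_ricMix_symm (i j : Fin n) :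
    ∑ m, F.ric i m * F.ricMix j m = ∑ m, F.ric j m * F.ricMix i m := by
  have e (i j : Fin n) : ∑ m, F.ric i m * F.ricMix j m = (F.ricMix * F.ric) j i := by
    rw [Matrix.mul_apply]
    exact Finset.sum_congr rfl fun m _ ↦ by rw [F.ric_symm i m, mul_comm]
  have t : (F.ricMix * F.ric).transpose = F.ricMix * F.ric := by
    have r : F.ric.transpose = F.ric := by ext a b; exact F.ric_symm b a
    rw [ricMix, Matrix.transpose_mul, Matrix.transpose_mul, r, F.h_symm, Matrix.mul_assoc]
  rw [e, e]
  exact congrFun (congrFun t i) j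

lemma g_mul_ricMix (i j : Fin n) : ∑ m, F.g i m * F.ricMix j m = F.ric i j := by
  have e : F.ricMix * F.g = F.ric := by rw [ricMix, mul_assoc, F.h_mul_g, mul_one]
  rw [F.ric_symm, ← e, Matrix.mul_apply]
  exact Finset.sum_congr rfl fun m _ ↦ by rw [F.g_symm_apply i m, mul_comm]

/-- Weyl compatibility of the Ricci tensor is its Riemann compatibility. -/
lemma sum_ric_mul_weyl (l i j k : Fin n) :
    ∑ m, (F.ric i m * F.weyl j k l m + F.ric j m * F.weyl k i l m + F.ric k m * F.weyl i j l m) =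
      F.cyc F.ric l i j k :=
  F.sum_mul_weyl _ F.ric_symm F.ric_mul_ricMix_symm l i j k

/-- The metric is Weyl compatible. -/
lemma sum_g_mul_weyl (l i j k : Fin n) :
    ∑ m, (F.g i m * F.weyl j k l m + F.g j m * F.weyl k i l m + F.g k m * F.weyl i j l m) = 0 := by
  rw [F.sum_mul_weyl _ F.g_symm_apply fun i j ↦ by rw [g_mul_ricMix, g_mul_ricMix, F.ric_symm],
    cyc_g]

/-- The Weyl tensor in terms of the trace-adjusted Ricci tensor. -/
lemma weyl_eq (c₁ c₂ : ℝ) (hc₁ : c₁ = 1 / ((n : ℝ) - 2))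
    (hc₂ : c₂ = 1 / (((n : ℝ) - 1) * ((n : ℝ) - 2))) (L X : Matrix (Fin n) (Fin n) A)
    (hL : L = c₁ • F.ric - (c₂ / 2) • F.scal • F.g)
    (hX : X = c₁ • F.ricMix - (c₂ / 2) • F.scal • (1 : Matrix (Fin n) (Fin n) A)) :
    F.weyl = fun j k l m ↦ F.curv j k l m +
      (((1 : Matrix (Fin n) (Fin n) A) j m * L k l + X j m * F.g k l) -
        ((1 : Matrix (Fin n) (Fin n) A) k m * L j l + X k m * F.g j l)) := by
  funext j k l m
  have h2 : algebraMap ℝ A c₂ = algebraMap ℝ A (c₂ / 2) + algebraMap ℝ A (c₂ / 2) := by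
    rw [← map_add, add_halves]
  simp only [weyl, hL, hX, ← hc₁, ← hc₂, Matrix.sub_apply, Matrix.smul_apply, smul_eq_mul]
  simp only [Algebra.smul_def, h2]
  ring

lemma divMix_ricMix (j : Fin n) : F.divMix F.ricMix j = (1 / 2 : ℝ) • F.d j F.scal := by
  apply eq_of_two_mul_eq
  rw [F.two_mul_divMix_ricMix, two_mul, ← add_smul]
  norm_num

/-- The divergence of the Weyl tensor is an exterior covariant derivative. -/
lemma div_weyl (hn : 3 ≤ n) : F.div F.weyl = F.covExt
      ((-(((n : ℝ) - 3) / ((n : ℝ) - 2))) • F.ric +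
        (((n : ℝ) - 3) / (2 * (((n : ℝ) - 1) * ((n : ℝ) - 2)))) • F.scal • F.g) := by
  have h3 : (3 : ℝ) ≤ n := by exact_mod_cast hn
  have h1 : (n : ℝ) - 1 ≠ 0 := by linarith
  have h2 : (n : ℝ) - 2 ≠ 0 := by linarith
  obtain ⟨c₁, hc₁⟩ : ∃ c : ℝ, c = 1 / ((n : ℝ) - 2) := ⟨_, rfl⟩
  obtain ⟨c₂, hc₂⟩ : ∃ c : ℝ, c = 1 / (((n : ℝ) - 1) * ((n : ℝ) - 2)) := ⟨_, rfl⟩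
  -- In the coefficient of `Ric`, `-1` comes from the divergence of the curvature and `c₁` from `L`.
  -- In that of `R g`, `-(c₂ / 2)` comes from `L` and `c₁ / 2 - c₂ / 2` from the divergence of `X`,
  -- via `2 ∇_m R_j{}^m = ∂_j R`. The scalar term of `C` is split equally between `L` and `X`.
  have k1 : -(((n : ℝ) - 3) / ((n : ℝ) - 2)) = -1 + c₁ := by rw [hc₁]; field_simp; ring
  have k2 : ((n : ℝ) - 3) / (2 * (((n : ℝ) - 1) * ((n : ℝ) - 2))) =
      -(c₂ / 2) + (c₁ / 2 - c₂ / 2) := by rw [hc₁, hc₂]; field_simp; ring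
  obtain ⟨L, hL⟩ : ∃ L, L = c₁ • F.ric - (c₂ / 2) • F.scal • F.g := ⟨_, rfl⟩
  obtain ⟨X, hX⟩ : ∃ X, X = c₁ • F.ricMix - (c₂ / 2) • F.scal • (1 : Matrix (Fin n) (Fin n) A) :=
    ⟨_, rfl⟩
  have hdX (j : Fin n) : F.divMix X j = (c₁ / 2 - c₂ / 2) • F.d j F.scal := by
    rw [hX, sub_eq_add_neg, ← neg_smul, divMix_add, divMix_smul, divMix_smul, divMix_smul_one,
      divMix_ricMix, smul_smul, ← add_smul]
    congr 1; ring
  have hLd (j k l : Fin n) :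
      F.div (fun a b c e ↦ (1 : Matrix (Fin n) (Fin n) A) a e * L b c) j k l -
        F.div (fun a b c e ↦ (1 : Matrix (Fin n) (Fin n) A) a e * L b c) k j l =
      F.covExt L j k l := by
    simp only [div_delta_mul, covExt, Finset.sum_add_distrib, Finset.sum_sub_distrib,
      F.conn_symm k j]
    ring
  funext j k l
  rw [F.weyl_eq c₁ c₂ hc₁ hc₂ L X hL hX, F.div_add (fun j k l m ↦ F.curv j k l m),
    F.div_antisymm fun j k l m ↦ (1 : Matrix (Fin n) (Fin n) A) j m * L k l + X j m * F.g k l,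
    F.div_add (fun j k l m ↦ (1 : Matrix (Fin n) (Fin n) A) j m * L k l),
    F.div_add (fun j k l m ↦ (1 : Matrix (Fin n) (Fin n) A) j m * L k l),
    add_sub_add_comm, hLd, F.div_mul_g X, F.div_mul_g X, F.div_curv, hdX, hdX, k1, k2, hL,
    sub_eq_add_neg, ← neg_smul]
  simp only [covExt_add, covExt_smul, covExt_smul_g]
  simp only [add_smul, neg_smul, one_smul, smul_mul_assoc, smul_sub]
  ring

/-- The exterior covariant derivative of the divergence of the Weyl tensor. -/
lemma covExtTwo_div_weyl (hn : 3 ≤ n) (l a b c : Fin n) :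
    F.covExtTwo (F.div F.weyl) l a b c =
      (-(((n : ℝ) - 3) / ((n : ℝ) - 2))) • F.cyc F.ric l a b c := by
  rw [div_weyl F hn, covExtTwo_covExt, cyc_add]
  have e (r : ℝ) (σ : Matrix (Fin n) (Fin n) A) : r • σ = algebraMap ℝ A r • σ := by
    rw [algebraMap_smul]
  rw [e, e, cyc_smul, cyc_smul, cyc_smul, cyc_g, mul_zero, mul_zero, add_zero, Algebra.smul_def]

lemma div_weyl_swap (hn : 3 ≤ n) (j k l : Fin n) :
    F.div F.weyl j k l = -F.div F.weyl k j l := by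
  rw [div_weyl F hn]
  simp only [covExt, Finset.sum_sub_distrib]
  ring

/-! ### Dimension three -/

lemma curv_self (j : Fin n) : F.curv j j = 0 := by
  simp only [curv, sub_self, add_zero]

/-- The cyclic sum of the Ricci tensor is trace-free. -/
lemma trace_cyc_ric (a b : Fin n) : ∑ c, ∑ l, F.h c l * F.cyc F.ric l a b c = 0 := by
  have e1 (a b : Fin n) : ∑ c, ∑ l, F.h c l * ∑ m, F.ric a m * F.curv b c l m
      = -∑ m, F.ric a m * F.ricMix b m := by
    have (b m : Fin n) : ∑ c, ∑ l, F.h c l * F.curv b c l m = -F.ricMix b m := by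
      rw [ricMix_eq, ← Finset.sum_neg_distrib]
      refine Finset.sum_congr rfl fun c _ ↦ ?_
      rw [← Matrix.mul_apply]
      exact congrFun (congrFun (F.h_mul_curv_transpose b c) m) c
    simp only [← mul_neg, ← Finset.sum_neg_distrib, ← this, Finset.mul_sum]
    symm
    rw [Finset.sum_comm]
    refine Finset.sum_congr rfl fun c _ ↦ ?_
    rw [Finset.sum_comm]
    exact Finset.sum_congr rfl fun l _ ↦ Finset.sum_congr rfl fun m _ ↦ by ring
  have e2 : ∑ c, ∑ l, F.h c l * ∑ m, F.ric c m * F.curv a b l m = 0 := by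
    -- A symmetric tensor is contracted with an antisymmetric one; the other two terms of the trace
    -- cancel because `Ric · h · Ric` is symmetric.
    have h : ∑ c, ∑ m, F.ric c m * (F.h * F.curv a b) c m = 0 := by
      refine sum_sum_eq_zero_of_antisymm _ fun i j ↦ ?_
      have t := congrFun (congrFun (F.h_mul_curv_transpose a b) j) i
      rw [Matrix.transpose_apply, Matrix.neg_apply] at t
      rw [t, F.ric_symm i j, mul_neg]
    rw [← h]
    refine Finset.sum_congr rfl fun c _ ↦ ?_
    simp only [Matrix.mul_apply, Finset.mul_sum]
    rw [Finset.sum_comm]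
    exact Finset.sum_congr rfl fun m _ ↦ Finset.sum_congr rfl fun l _ ↦ by ring
  have e3 : ∑ c, ∑ l, F.h c l * ∑ m, F.ric b m * F.curv c a l m
      = ∑ m, F.ric b m * F.ricMix a m := by
    have h := e1 b a
    simp only [F.curv_swap a, Matrix.neg_apply, mul_neg, Finset.sum_neg_distrib, neg_inj] at h
    exact h
  simp only [cyc, Finset.sum_add_distrib, mul_add, e1, e2, e3]
  rw [F.ric_mul_ricMix_symm]
  ring

/-- In dimension three the Ricci tensor is Riemann compatible. -/
lemma cyc_ric_eq_zero_of_three (F : FormalMetric 3 A) (l a b c : Fin 3) :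
    F.cyc F.ric l a b c = 0 := by
  have rot (l a b c : Fin 3) : F.cyc F.ric l a b c = F.cyc F.ric l b c a := by
    simp only [cyc, Finset.sum_add_distrib]; ring
  have swap (l a b c : Fin 3) : F.cyc F.ric l a b c = -F.cyc F.ric l b a c := by
    simp only [cyc, Finset.sum_add_distrib]
    rw [F.curv_swap b c, F.curv_swap c a, F.curv_swap a b]
    simp only [Matrix.neg_apply, mul_neg, Finset.sum_neg_distrib]
    ring
  have diag (l a c : Fin 3) : F.cyc F.ric l a a c = 0 := by
    simp only [cyc, Finset.sum_add_distrib]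
    rw [F.curv_swap c a, F.curv_self]
    simp
  have diag' (l a c : Fin 3) : F.cyc F.ric l a c a = 0 := by rw [rot, rot]; exact diag l a c
  have diag'' (l a c : Fin 3) : F.cyc F.ric l c a a = 0 := by rw [rot]; exact diag l a c
  -- An alternating cyclic sum on three indices is determined by its value at `0 1 2`, a covector in
  -- `l`. With `a, b` fixed and distinct, the trace over `c` has one surviving term, so the three
  -- traces say that `h` kills this covector.
  have key : F.h.mulVec (fun l ↦ F.cyc F.ric l 0 1 2) = 0 := by
    have t0 := F.trace_cyc_ric 1 2
    have t1 := F.trace_cyc_ric 2 0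
    have t2 := F.trace_cyc_ric 0 1
    ext c
    simp only [Matrix.mulVec, dotProduct, Pi.zero_apply]
    rw [Fin.sum_univ_three] at t0 t1 t2
    simp only [diag', diag'', mul_zero, Finset.sum_const_zero, add_zero, zero_add] at t0 t1 t2
    match c with
    | 0 => simpa only [rot _ 0 1 2] using t0
    | 1 => simpa only [rot _ 2 0 1] using t1
    | 2 => exact t2
  have z (l : Fin 3) : F.cyc F.ric l 0 1 2 = 0 := by
    have h := congrArg F.g.mulVec key
    rw [Matrix.mulVec_mulVec, F.g_mul_h, Matrix.one_mulVec, Matrix.mulVec_zero] at h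
    exact congrFun h l
  have z1 : F.cyc F.ric l 1 2 0 = 0 := by rw [← rot, z]
  have z2 : F.cyc F.ric l 2 0 1 = 0 := by rw [rot, z]
  have cases : ∀ a b c : Fin 3, a = b ∨ a = c ∨ b = c ∨ (a = 0 ∧ b = 1 ∧ c = 2) ∨
      (a = 1 ∧ b = 2 ∧ c = 0) ∨ (a = 2 ∧ b = 0 ∧ c = 1) ∨ (b = 0 ∧ a = 1 ∧ c = 2) ∨
      (b = 1 ∧ a = 2 ∧ c = 0) ∨ (b = 2 ∧ a = 0 ∧ c = 1) := by decide
  obtain rfl | rfl | rfl | ⟨rfl, rfl, rfl⟩ | ⟨rfl, rfl, rfl⟩ | ⟨rfl, rfl, rfl⟩ | ⟨rfl, rfl, rfl⟩ |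
    ⟨rfl, rfl, rfl⟩ | ⟨rfl, rfl, rfl⟩ := cases a b c
  · exact diag _ _ _
  · exact diag' _ _ _
  · exact diag'' _ _ _
  · exact z l
  · exact z1
  · exact z2
  · rw [swap, z, neg_zero]
  · rw [swap, z1, neg_zero]
  · rw [swap, z2, neg_zero]

/-- The Ricci tensor is Riemann compatible exactly where the exterior covariant derivative of the
divergence of the Weyl tensor vanishes. -/
lemma exists_cyc_ric_eq_smul (hn : 3 ≤ n) : ∃ r : ℝ, ∀ l a b c,
    F.cyc F.ric l a b c = r • F.covExtTwo (F.div F.weyl) l a b c := by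
  -- For `n = 3` the factor `n - 3` is not invertible, but the left side is zero, so `r = 0` serves.
  obtain rfl | h4 := hn.eq_or_lt
  · exact ⟨0, fun l a b c ↦ by rw [cyc_ric_eq_zero_of_three, zero_smul]⟩
  · have h4' : (4 : ℝ) ≤ n := by exact_mod_cast h4
    have h2 : (n : ℝ) - 2 ≠ 0 := by linarith
    have h3 : (n : ℝ) - 3 ≠ 0 := by linarith
    refine ⟨(-(((n : ℝ) - 3) / ((n : ℝ) - 2)))⁻¹, fun l a b c ↦ ?_⟩
    rw [covExtTwo_div_weyl F hn, smul_smul, inv_mul_cancel₀ (neg_ne_zero.mpr (div_ne_zero h3 h2)),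
      one_smul]

end FormalMetric
end PseudoRiemannian

/-! ### Metric components in a chart -/

namespace PseudoRiemannian

variable {n : ℕ} {M : Type*} [TopologicalSpace M] [ChartedSpace (Coord n) M]
  [IsManifold (𝓡 n) ∞ M]

lemma contMDiffOn_coordinate_field {e : OpenPartialHomeomorph M (Coord n)}
    (he : e ∈ IsManifold.maximalAtlas (𝓡 n) ∞ M) (v : Coord n) :
    ContMDiffOn (𝓡 n) (𝓡 n).tangent ∞
      (fun y ↦ (⟨e.symm y, mfderiv (𝓡 n) (𝓡 n) e.symm y v⟩ : TangentBundle (𝓡 n) M)) e.target := by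
  have h1 : ContMDiffOn (𝓡 n).tangent (𝓡 n).tangent ∞ (tangentMapWithin (𝓡 n) (𝓡 n) e.symm e.target)
      (Bundle.TotalSpace.proj ⁻¹' e.target) :=
    (contMDiffOn_symm_of_mem_maximalAtlas he).contMDiffOn_tangentMapWithin (by simp)
      e.open_target.uniqueMDiffOn
  have h2 : ContMDiffOn (𝓡 n) (𝓡 n).tangent ∞
      (fun y : Coord n ↦ (⟨y, v⟩ : TangentBundle (𝓡 n) (Coord n))) e.target :=
    contMDiffOn_vectorSpace_iff_contDiffOn.mpr contDiffOn_const
  refine (h1.comp h2 fun y hy ↦ hy).congr fun y hy ↦ ?_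
  simp only [Function.comp_apply, tangentMapWithin, mfderivWithin_of_isOpen e.open_target hy]

/-- The components of the metric are smooth. -/
lemma Metric.contDiffOn_components (g : Metric n M) {e : OpenPartialHomeomorph M (Coord n)}
    (he : e ∈ IsManifold.maximalAtlas (𝓡 n) ∞ M) (i j : Fin n) :
    ContDiffOn ℝ ∞ (fun y ↦ g.components e y i j) e.target := by
  rw [← contMDiffOn_iff_contDiffOn]
  intro y hy
  -- A component is the smooth bilinear form evaluated on two smooth coordinate fields, viewed as a
  -- section of the trivial line bundle.
  have : ContMDiffWithinAt (𝓡 n) ((𝓡 n).prod 𝓘(ℝ)) ∞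
      (fun z ↦ Bundle.TotalSpace.mk' ℝ (E := Bundle.Trivial M ℝ) (e.symm z)
        (g.components e z i j)) e.target y := by
    apply ContMDiffWithinAt.clm_bundle_apply₂ (F₁ := Coord n) (F₂ := Coord n)
    · exact ContMDiffAt.comp_contMDiffWithinAt y g.contMDiff.contMDiffAt
        (contMDiffOn_symm_of_mem_maximalAtlas he y hy)
    · exact contMDiffOn_coordinate_field he _ y hy
    · exact contMDiffOn_coordinate_field he _ y hy
  simp only [Bundle.contMDiffWithinAt_totalSpace] at this
  exact this.2

lemma Metric.components_symm (g : Metric n M) (e : OpenPartialHomeomorph M (Coord n)) (y : Coord n)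
    (i j : Fin n) : g.components e y i j = g.components e y j i :=
  g.symm _ _ _

/-- The matrix of components of the metric is invertible. -/
lemma Metric.det_components_ne_zero (g : Metric n M) {e : OpenPartialHomeomorph M (Coord n)}
    (he : e ∈ IsManifold.maximalAtlas (𝓡 n) ∞ M) {y : Coord n} (hy : y ∈ e.target) :
    (g.components e y).det ≠ 0 := by
  intro h0
  obtain ⟨v, hv, hv0⟩ := Matrix.exists_mulVec_eq_zero_iff.mpr h0
  have hm : e.MDifferentiable (𝓡 n) (𝓡 n) :=
    ⟨(contMDiffOn_of_mem_maximalAtlas he).mdifferentiableOn (by simp),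
      (contMDiffOn_symm_of_mem_maximalAtlas he).mdifferentiableOn (by simp)⟩
  -- As the coordinate vectors span the tangent space, a null vector of the matrix gives a tangent
  -- vector orthogonal to everything.
  have hb := hm.symm.mfderiv_bijective (x := y) hy
  obtain ⟨Φ, hΦ⟩ : ∃ Φ : Coord n →L[ℝ] TangentSpace (𝓡 n) (e.symm y),
    Φ = mfderiv (𝓡 n) (𝓡 n) e.symm y := ⟨_, rfl⟩
  have hΦb : Function.Bijective Φ := by rw [hΦ]; exact hb
  have hc (i j : Fin n) : g.components e y i j = g.inner (e.symm y)
      (Φ (EuclideanSpace.single i 1)) (Φ (EuclideanSpace.single j 1)) := by rw [hΦ]; rfl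
  have hsum (u : Coord n) : u = ∑ j, u j • EuclideanSpace.single j (1 : ℝ) := by
    simpa using ((EuclideanSpace.basisFun (Fin n) ℝ).sum_repr u).symm
  have hw (i : Fin n) : g.inner (e.symm y) (Φ (EuclideanSpace.single i 1))
      (Φ (WithLp.toLp 2 v)) = 0 := by
    have := congrFun hv0 i
    rw [Matrix.mulVec, dotProduct] at this
    rw [hsum (WithLp.toLp 2 v)]
    simp only [map_sum, map_smul, smul_eq_mul, ← hc]
    simpa [mul_comm] using this
  have hall (u : TangentSpace (𝓡 n) (e.symm y)) :
      g.inner (e.symm y) (Φ (WithLp.toLp 2 v)) u = 0 := by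
    obtain ⟨u, rfl⟩ := hΦb.2 u
    rw [g.symm, hsum u]
    simp only [map_sum, map_smul, sum_apply, smul_apply, hw,
      smul_zero, Finset.sum_const_zero]
  have hz := hΦb.1 ((g.nondegenerate _ _ hall).trans (map_zero Φ).symm)
  exact hv (by simpa using congrArg WithLp.ofLp hz)

end PseudoRiemannian

/-! ### Smooth functions on an open set as a differential algebra -/

namespace PseudoRiemannian

variable {n : ℕ} (U : TopologicalSpace.Opens (Coord n))

/-- The algebra of smooth functions on an open subset of coordinate space. -/
def SmoothFun : Subalgebra ℝ (U → ℝ) where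
  carrier := {f | ∃ F : Coord n → ℝ, ContDiffOn ℝ ∞ F U ∧ ∀ x : U, F x = f x}
  mul_mem' := by
    rintro _ _ ⟨F, hF, hF'⟩ ⟨G, hG, hG'⟩
    exact ⟨fun y ↦ F y * G y, hF.mul hG, fun x ↦ by simp [hF', hG']⟩
  add_mem' := by
    rintro _ _ ⟨F, hF, hF'⟩ ⟨G, hG, hG'⟩
    exact ⟨fun y ↦ F y + G y, hF.add hG, fun x ↦ by simp [hF', hG']⟩
  algebraMap_mem' r := ⟨fun _ ↦ r, contDiffOn_const, fun _ ↦ rfl⟩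

namespace SmoothFun

variable {U}

/-- Evaluation at a point. -/
def ev (x : U) : SmoothFun U →ₐ[ℝ] ℝ := (Pi.evalAlgHom ℝ (fun _ : U ↦ ℝ) x).comp (SmoothFun U).val

lemma ext_ev {a b : SmoothFun U} (h : ∀ x, ev x a = ev x b) : a = b := Subtype.ext (funext h)

/-- The function `F` on coordinate space restricts to the smooth function `a` on `U`. -/
def Represents (a : SmoothFun U) (F : Coord n → ℝ) : Prop := ∀ x : U, F x = ev x a

/-- The smooth function on `U` given by a function on coordinate space which is smooth on `U`. -/
def ofFun (F : Coord n → ℝ) (hF : ContDiffOn ℝ ∞ F U) : SmoothFun U :=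
  ⟨fun x ↦ F x, F, hF, fun _ ↦ rfl⟩

lemma represents_ofFun (F : Coord n → ℝ) (hF : ContDiffOn ℝ ∞ F U) :
    Represents (ofFun F hF) F := fun _ ↦ rfl

/-- Because `U` is open, agreement on `U` is agreement near each of its points, so derivatives do
not depend on the chosen extension. -/
lemma Represents.eventuallyEq {a : SmoothFun U} {F G : Coord n → ℝ} (hF : Represents a F)
    (hG : Represents a G) (x : U) : F =ᶠ[𝓝 (x : Coord n)] G := by
  filter_upwards [U.isOpen.mem_nhds x.2] with y hy
  exact (hF ⟨y, hy⟩).trans (hG ⟨y, hy⟩).symm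

/-- An extension to coordinate space. -/
def extend (a : SmoothFun U) : Coord n → ℝ := a.2.choose

lemma contDiffOn_extend (a : SmoothFun U) : ContDiffOn ℝ ∞ (extend a) U := a.2.choose_spec.1

lemma represents_extend (a : SmoothFun U) : Represents a (extend a) := a.2.choose_spec.2

lemma contDiffAt_extend (a : SmoothFun U) (x : U) : ContDiffAt ℝ ∞ (extend a) x :=
  (contDiffOn_extend a).contDiffAt (U.isOpen.mem_nhds x.2)

lemma differentiableAt_extend (a : SmoothFun U) (x : U) : DifferentiableAt ℝ (extend a) x :=
  (contDiffAt_extend a x).differentiableAt (by simp)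

lemma contDiffOn_pderiv (i : Fin n) {F : Coord n → ℝ} (hF : ContDiffOn ℝ ∞ F U) :
    ContDiffOn ℝ ∞ (pderiv i F) U :=
  (hF.fderiv_of_isOpen U.isOpen (by simp)).clm_apply contDiffOn_const

lemma Represents.pderiv_eq {a : SmoothFun U} {F G : Coord n → ℝ} (hF : Represents a F)
    (hG : Represents a G) (i : Fin n) (x : U) : pderiv i F x = pderiv i G x := by
  rw [pderiv, pderiv, (hF.eventuallyEq hG x).fderiv_eq]

/-- The partial derivative. -/
def dFun (i : Fin n) (a : SmoothFun U) : SmoothFun U :=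
  ofFun (pderiv i (extend a)) (contDiffOn_pderiv i (contDiffOn_extend a))

lemma represents_dFun (i : Fin n) {a : SmoothFun U} {F : Coord n → ℝ} (hF : Represents a F) :
    Represents (dFun i a) (pderiv i F) := fun x ↦ hF.pderiv_eq (represents_extend a) i x

/-- The partial derivative as a derivation. -/
def d (i : Fin n) : Derivation ℝ (SmoothFun U) (SmoothFun U) :=
  Derivation.mk'
    { toFun := dFun i
      map_add' := fun a b ↦ ext_ev fun x ↦ by
        have h : Represents (a + b) (fun y ↦ extend a y + extend b y) := fun x ↦ by
          simp only [map_add, represents_extend a x, represents_extend b x]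
        rw [map_add, ← represents_dFun i h, ← represents_dFun i (represents_extend a),
          ← represents_dFun i (represents_extend b), pderiv,
          fderiv_fun_add (differentiableAt_extend a x) (differentiableAt_extend b x)]
        rfl
      map_smul' := fun r a ↦ ext_ev fun x ↦ by
        have h : Represents (r • a) (fun y ↦ r • extend a y) := fun x ↦ by
          simp only [map_smul, represents_extend a x]
        rw [map_smul, ← represents_dFun i h, RingHom.id_apply,
          ← represents_dFun i (represents_extend a), pderiv,
          fderiv_fun_const_smul (differentiableAt_extend a x)]
        rfl }
    fun a b ↦ ext_ev fun x ↦ by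
      have h : Represents (a * b) (fun y ↦ extend a y * extend b y) := fun x ↦ by
        simp only [map_mul, represents_extend a x, represents_extend b x]
      change ev x (dFun i (a * b)) = ev x (a * dFun i b + b * dFun i a)
      rw [map_add, map_mul, map_mul, ← represents_dFun i h,
        ← represents_dFun i (represents_extend a), ← represents_dFun i (represents_extend b),
        ← represents_extend a, ← represents_extend b,
        pderiv, fderiv_fun_mul (differentiableAt_extend a x) (differentiableAt_extend b x)]
      rfl

lemma Represents.d {a : SmoothFun U} {F : Coord n → ℝ} (hF : Represents a F) (i : Fin n) :
    Represents (d i a) (pderiv i F) := represents_dFun i hF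

/-- Symmetry of the second derivative of a smooth function. -/
lemma d_comm (i j : Fin n) (a : SmoothFun U) : d i (d j a) = d j (d i a) := by
  refine ext_ev fun x ↦ ?_
  have hs := (contDiffAt_extend a x).isSymmSndFDerivAt
    (by simp; exact WithTop.coe_le_coe.mpr le_top)
  have hd : DifferentiableAt ℝ (fderiv ℝ (extend a)) x :=
    ((contDiffAt_extend a x).fderiv_right (m := ∞) (by simp)).differentiableAt (by simp)
  have e (i j : Fin n) : pderiv i (pderiv j (extend a)) x =
      fderiv ℝ (fderiv ℝ (extend a)) x (EuclideanSpace.single i 1) (EuclideanSpace.single j 1) := by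
    unfold pderiv
    rw [fderiv_clm_apply hd (differentiableAt_const _)]
    simp
  rw [← ((represents_extend a).d j).d i, ← ((represents_extend a).d i).d j, e, e, hs.eq]

lemma isUnit_of_ne_zero (a : SmoothFun U) (ha : ∀ x, ev x a ≠ 0) : IsUnit a := by
  have hi : ContDiffOn ℝ ∞ (fun y ↦ (extend a y)⁻¹) U :=
    (contDiffOn_extend a).inv fun y hy ↦ by
      have := ha ⟨y, hy⟩
      rwa [← represents_extend a] at this
  refine IsUnit.of_mul_eq_one (ofFun _ hi) (ext_ev fun x ↦ ?_)
  simp only [map_mul, map_one, ← represents_ofFun _ hi x, represents_extend a x,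
    mul_inv_cancel₀ (ha x)]

end SmoothFun

open SmoothFun

variable {U}

/-- A smooth symmetric invertible matrix of functions on an open set as a metric over the algebra of
smooth functions. -/
def FormalMetric.ofComponents (G : Coord n → Matrix (Fin n) (Fin n) ℝ)
    (hG : ∀ i j, ContDiffOn ℝ ∞ (fun y ↦ G y i j) U) (hs : ∀ y ∈ U, ∀ i j, G y i j = G y j i)
    (hdet : ∀ y ∈ U, (G y).det ≠ 0) : FormalMetric n (SmoothFun U) where
  d := SmoothFun.d
  d_comm := SmoothFun.d_comm
  g := Matrix.of fun i j ↦ ofFun _ (hG i j)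
  h := (Matrix.of fun i j ↦ ofFun _ (hG i j))⁻¹
  g_symm := by
    ext i j x
    exact hs x x.2 j i
  g_mul_h := Matrix.mul_nonsing_inv _ <| isUnit_of_ne_zero _ fun x ↦ by
    rw [AlgHom.map_det]
    exact hdet x x.2

/-- The metric over the algebra of smooth functions on `U` is given by the matrix `G`. -/
structure FormalMetric.IsRep (F : FormalMetric n (SmoothFun U))
    (G : Coord n → Matrix (Fin n) (Fin n) ℝ) : Prop where
  d (i : Fin n) : F.d i = SmoothFun.d i
  g (i j : Fin n) : Represents (F.g i j) fun y ↦ G y i j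

lemma FormalMetric.isRep_ofComponents (G : Coord n → Matrix (Fin n) (Fin n) ℝ)
    (hG : ∀ i j, ContDiffOn ℝ ∞ (fun y ↦ G y i j) U) (hs : ∀ y ∈ U, ∀ i j, G y i j = G y j i)
    (hdet : ∀ y ∈ U, (G y).det ≠ 0) : (FormalMetric.ofComponents G hG hs hdet).IsRep G :=
  ⟨fun _ ↦ rfl, fun i j ↦ represents_ofFun _ (hG i j)⟩

/-! ### Coordinate tensors as values of formal tensors -/

namespace FormalMetric.IsRep

variable {F : FormalMetric n (SmoothFun U)} {G : Coord n → Matrix (Fin n) (Fin n) ℝ}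
  (R : F.IsRep G)
include R

lemma deriv {a : SmoothFun U} {f : Coord n → ℝ} (hf : Represents a f) (i : Fin n) :
    Represents (F.d i a) (pderiv i f) := by
  rw [R.d]; exact hf.d i

lemma h (i j : Fin n) : Represents (F.h i j) fun y ↦ (G y)⁻¹ i j := fun x ↦ by
  change (G x)⁻¹ i j = _
  have e : G x = F.g.map (ev x) := by ext i j; exact R.g i j x
  have e2 : (G x)⁻¹ = F.h.map (ev x) := by
    apply Matrix.inv_eq_right_inv
    rw [e, ← Matrix.map_mul, F.g_mul_h, Matrix.map_one _ (map_zero _) (map_one _)]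
  rw [e2]; rfl

lemma christoffel (m i j : Fin n) : Represents (F.conn i j m) (christoffel G m i j) := fun x ↦ by
  simp only [PseudoRiemannian.christoffel, conn, Matrix.mul_apply, lowConn, Matrix.of_apply,
    map_sum, map_mul, map_smul, map_sub, map_add, ← R.h _ _ x, ← R.deriv (R.g _ _) _ x,
    Finset.mul_sum, smul_eq_mul]
  refine Finset.sum_congr rfl fun p _ ↦ ?_
  have e : (G x)⁻¹ m p = (G x)⁻¹ p m := by
    have h := congrArg (ev x) (F.h_symm_apply m p)
    rwa [← R.h m p x, ← R.h p m x] at h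
  rw [e]
  ring

lemma riemann (j k l m : Fin n) : Represents (F.curv j k l m) (riemann G j k l m) := fun x ↦ by
  simp only [PseudoRiemannian.riemann, curv, Matrix.add_apply, Matrix.sub_apply, dMat_apply,
    Matrix.mul_apply, map_sum, map_mul, map_sub, map_add, ← R.christoffel _ _ _ x,
    ← R.deriv (R.christoffel _ _ _) _ x, Finset.sum_sub_distrib, mul_comm]

lemma ricci (a b : Fin n) : Represents (F.ric a b) (ricci G a b) := fun x ↦ by
  simp only [PseudoRiemannian.ricci, ric, Matrix.of_apply, map_sum, ← R.riemann _ _ _ _ x]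

lemma ricciMixed (j m : Fin n) : Represents (F.ricMix j m) (ricciMixed G j m) := fun x ↦ by
  simp only [PseudoRiemannian.ricciMixed, ricMix, Matrix.mul_apply, map_sum, map_mul,
    ← R.ricci _ _ x, ← R.h _ _ x]

lemma scalar : Represents F.scal (scalar G) := fun x ↦ by
  simp only [PseudoRiemannian.scalar, scal, Matrix.trace, Matrix.diag_apply, map_sum,
    ← R.ricciMixed _ _ x]

omit R in
lemma delta (j m : Fin n) (x : U) :
    ev x ((1 : Matrix (Fin n) (Fin n) (SmoothFun U)) j m) = delta j m := by
  rw [PseudoRiemannian.delta, Matrix.one_apply]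
  split_ifs
  · exact map_one _
  · exact map_zero _

lemma weyl (j k l m : Fin n) :
    Represents (F.weyl j k l m) (PseudoRiemannian.weyl G j k l m) := fun x ↦ by
  simp only [PseudoRiemannian.weyl, FormalMetric.weyl, map_mul, map_sub, map_add, map_smul,
    smul_eq_mul, ← R.ricci _ _ x, ← R.ricciMixed _ _ x, ← R.g _ _ x, ← R.scalar x, delta,
    ← R.riemann _ _ _ _ x]

lemma divWeyl (j k l : Fin n) : Represents (F.div F.weyl j k l) (divWeyl G j k l) := fun x ↦ by
  simp only [PseudoRiemannian.divWeyl, nablaWeyl, div, nabla, map_sum, map_mul, map_sub, map_add,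
    map_neg, ← R.christoffel _ _ _ x, ← R.weyl _ _ _ _ x, ← R.deriv (R.weyl _ _ _ _) _ x]

/-- The wedge antisymmetrizes a divergence already antisymmetric in its first two indices, hence the
factor `2`. -/
lemma weylForm (hn : 3 ≤ n) (l a b : Fin n) :
    Represents ((2 : ℝ) • F.div F.weyl a b l) (weylForm G l a b) := fun x ↦ by
  have e : PseudoRiemannian.weylForm G l a b x =
      PseudoRiemannian.divWeyl G a b l x - PseudoRiemannian.divWeyl G b a l x := by
    simp [PseudoRiemannian.weylForm, PseudoRiemannian.delta, mul_sub, Finset.sum_sub_distrib]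
  rw [e, R.divWeyl a b l x, R.divWeyl b a l x, F.div_weyl_swap hn b a l, map_neg, map_smul,
    smul_eq_mul]
  ring

lemma extCovDeriv_weylForm (hn : 3 ≤ n) (l a b c : Fin n) (x : U) :
    extCovDeriv G (PseudoRiemannian.weylForm G) l a b c x =
      2 * ev x (F.covExtTwo (F.div F.weyl) l a b c) := by
  simp only [extCovDeriv, extDerivTwoForm, wedgeOneTwo, covExtTwo, map_sum, map_mul, map_sub,
    map_add, R.deriv (R.weylForm hn _ _ _) _ x, R.weylForm hn _ _ _ x, R.christoffel _ _ _ x,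
    Derivation.map_smul, map_smul, smul_eq_mul, mul_sub, mul_add, Finset.mul_sum]
  congr 1
  exact Finset.sum_congr rfl fun p _ ↦ by ring

/-- The Weyl compatibility condition for `t R_{ij} + s R g_{ij}`. -/
lemma sum_mul_weyl (t s : ℝ) (l i j k : Fin n) (x : U) (b : Fin n → Fin n → ℝ)
    (hb : ∀ i j, b i j = t * (PseudoRiemannian.ricci G i j x
      + s * PseudoRiemannian.scalar G x * G x i j)) :
    ∑ m, (b i m * PseudoRiemannian.weyl G j k l m x + b j m * PseudoRiemannian.weyl G k i l m x +
      b k m * PseudoRiemannian.weyl G i j l m x) = t * ev x (F.cyc F.ric l i j k) := by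
  have e1 := congrArg (ev x) (F.sum_ric_mul_weyl l i j k)
  have e2 := congrArg (ev x) (F.sum_g_mul_weyl l i j k)
  simp only [map_sum, map_add, map_mul, map_zero, ← R.ricci _ _ x, ← R.g _ _ x,
    ← R.weyl _ _ _ _ x] at e1 e2
  have e3 := congrArg₂ (fun u v ↦ t * u + t * s * PseudoRiemannian.scalar G x * v) e1 e2
  simp only [mul_zero, add_zero, Finset.mul_sum, ← Finset.sum_add_distrib] at e3
  rw [← e3]
  exact Finset.sum_congr rfl fun m _ ↦ by rw [hb, hb, hb]; ring

end FormalMetric.IsRep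

/-! ### The equivalence on the manifold -/

/-- A nonzero combination `t (R_{ij} + s R g_{ij})` is Weyl compatible if and only if
`D Π_l = 0`. -/
lemma Metric.isWeylCompatible_iff {M : Type*} [TopologicalSpace M] [ChartedSpace (Coord n) M]
    [IsManifold (𝓡 n) ∞ M] (g : Metric n M) (hn : 3 ≤ n) (t s : ℝ) (ht : t ≠ 0)
    (b : OpenPartialHomeomorph M (Coord n) → Fin n → Fin n → Coord n → ℝ)
    (hb : ∀ e i j y, b e i j y = t * (ricci (g.components e) i j y
      + s * scalar (g.components e) y * g.components e y i j)) :
    g.IsWeylCompatible b ↔ g.WeylFormClosed := by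
  refine forall₂_congr fun e he ↦ forall₂_congr fun y hy ↦ ?_
  obtain ⟨U, hU⟩ : ∃ U : TopologicalSpace.Opens (Coord n), U = ⟨e.target, e.open_target⟩ :=
    ⟨_, rfl⟩
  have hyU : y ∈ U := by rw [hU]; exact hy
  obtain ⟨F, R⟩ : ∃ F : FormalMetric n (SmoothFun U), F.IsRep (g.components e) := by
    subst hU
    exact ⟨_, FormalMetric.isRep_ofComponents _ (g.contDiffOn_components he)
      (fun y _ ↦ g.components_symm e y) fun y hy ↦ g.det_components_ne_zero he hy⟩
  have hsymm (i j : Fin n) : b e i j y = b e j i y := by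
    rw [hb, hb, g.components_symm, R.ricci i j ⟨y, hyU⟩, F.ric_symm, ← R.ricci j i ⟨y, hyU⟩]
  have key (i j k l : Fin n) := R.sum_mul_weyl t s l i j k ⟨y, hyU⟩ (fun i j ↦ b e i j y)
    fun i j ↦ hb e i j y
  have closed (l a b c : Fin n) := R.extCovDeriv_weylForm hn l a b c ⟨y, hyU⟩
  constructor
  · rintro ⟨-, h⟩ l i j k
    have hz : ev ⟨y, hyU⟩ (F.cyc F.ric l i j k) = 0 :=
      (mul_eq_zero.mp ((key i j k l).symm.trans (h i j k l))).resolve_left ht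
    refine (closed l i j k).trans ?_
    rw [F.covExtTwo_div_weyl hn, map_smul, hz, smul_zero, mul_zero]
  · intro h
    refine ⟨hsymm, fun i j k l ↦ (key i j k l).trans ?_⟩
    obtain ⟨r, hr⟩ := F.exists_cyc_ric_eq_smul hn
    have hz := (mul_eq_zero.mp ((closed l i j k).symm.trans (h l i j k))).resolve_left two_ne_zero
    rw [hr, map_smul, hz, smul_zero, mul_zero]

end PseudoRiemannian

end

theorem mainTheorem9 {n : ℕ} (hn : 3 ≤ n) {M : Type*} [TopologicalSpace M]
    [ChartedSpace (PseudoRiemannian.Coord n) M] [IsManifold (𝓡 n) ∞ M]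
    (g : PseudoRiemannian.Metric n M) :
    (g.IsWeylCompatible g.ricciTensor ↔ g.WeylFormClosed) ∧
      (g.IsWeylCompatible g.stressEnergyTensor ↔ g.WeylFormClosed) := by
  -- The Ricci tensor has `t = 1, s = 0`; Einstein's equations give `t = 1 / (8π), s = -1/2`.
  refine ⟨g.isWeylCompatible_iff hn 1 0 one_ne_zero _ fun e i j y ↦ ?_,
    g.isWeylCompatible_iff hn (1 / (8 * Real.pi)) (-(1 / 2)) (by positivity) _ fun e i j y ↦ ?_⟩
  · rw [PseudoRiemannian.Metric.ricciTensor]; ring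
  · rw [PseudoRiemannian.Metric.stressEnergyTensor, PseudoRiemannian.stressEnergy]; ring
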